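/- Let $\mathcal{C}$ be an abelian category, $I$ a nonempty finite set, and for each $i\in I$ let $\mathcal{C}_i$ be an abelian category, $G_i:\mathcal{C}\to\mathcal{C}_i$ a faithful exact functor, and $F_i:\mathcal{C}_i\to\mathcal{C}$ a left adjoint of $G_i$. Suppose that each $F_i$ is exact and resolving, i.e. every object of $\mathcal{C}_i$ admits an epimorphism from a projective object $P$ such that $F_iP$ is projective. Let $FG=\bigoplus_{i\in I}F_iG_i:\mathcal{C}\to\mathcal{C}$, and let $\epsilon_Y: FGY\to Y$ be the counit map of the adjunction between $F=\bigoplus_i F_i:\prod_i\mathcal{C}_i\to\mathcal{C}$ and $G=(G_i)_i$; it is an epimorphism. Let $E_0$ be the class of short exact sequences isomorphic to one of the form $0\to\ker\epsilon_Y\to FGY\to Y\to 0$ with $Y$ an object of $\mathcal{C}$, and let $E$ be the allowable class of relative homological algebra which it determines, namely the class of all short exact sequences in $\mathcal{C}$ that become split under every $G_i$. For a class $W$ of short exact sequences, an object $J$ is $W$-injective if for every $0\to A\to B\to Q\to 0$ in $W$ every morphism $A\to J$ extends to $B$; $\mathcal{C}$ has enough $W$-injectives if every object $A$ fits into a sequence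 $0\to A\to J\to Q\to 0$ in $W$ with $J$ a $W$-injective; and a contravariant functor $T$ from $\mathcal{C}$ to abelian groups is left $W$-exact if $0\to T(Q)\to T(B)\to T(A)$ is exact for every $0\to A\to B\to Q\to 0$ in $W$. For objects $X,Y$ of $\mathcal{C}$ put $U_0=V_1=Y$, $V_0=0$, $U_s=FGV_s$ and $V_{s+1}=\ker(\epsilon_{V_s}:U_s\to V_s)$ for $s\ge 1$. The compatible splitting spectral sequence of $(Y,X)$ is the spectral sequence $$E_1^{s,t}=\operatorname{Ext}^t_{\mathcal{C}}(U_s,X),\qquad d_r:E_r^{s,t}\to E_r^{s+r,t-r+1},$$ of the resolution $\cdots\to U_2\to U_1\to U_0\to 0$, i.e. that of the exact couple formed by the long exact sequences of $\operatorname{Ext}^*_{\mathcal{C}}(-,X)$ for the short exact sequences $0\to V_{s+1}\to U_s\to V_s\to 0$. Suppose that $\mathcal{C}$ has enough $E$-injectives. Let $X$ be an object of $\mathcal{C}$ and $t\ge 0$ an integer. Then the functor $\operatorname{Ext}^t_{\mathcal{C}}(-,X)$ is left $E$-exact if and only if, for all objects $Y$ of $\mathcal{C}$, the groups $E_2^{0,t}$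 and $E_2^{1,t}$ of the compatible splitting spectral sequence of $(Y,X)$ vanish. The same equivalence holds with left $E_0$-exactness in place of left $E$-exactness. -/

import Mathlib

open CategoryTheory Limits Abelian

universe w v u v₂ u₂ u₁

attribute [local instance 2000] CategoryTheory.CategoryStruct.toQuiver

noncomputable section

/-- A first quadrant exact couple of abelian groups
`D (s + 1, t) → D (s, t + 1) → E (s, t + 1) → D (s + 1, t + 1)`; the groups with a negative index
are zero, which is what the last two fields express. -/
structure ExactCouple where
  D : ℕ × ℕ → Type w
  E : ℕ × ℕ → Type w
  [grpD : ∀ p, AddCommGroup (D p)]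
  [grpE : ∀ p, AddCommGroup (E p)]
  i (s t : ℕ) : D (s + 1, t) →+ D (s, t + 1)
  j (s t : ℕ) : D (s, t) →+ E (s, t)
  k (s t : ℕ) : E (s, t) →+ D (s + 1, t)
  exact_jk (s t : ℕ) : Function.Exact (j s t) (k s t)
  exact_ki (s t : ℕ) : Function.Exact (k s t) (i s t)
  exact_ij (s t : ℕ) : Function.Exact (i s t) (j s (t + 1))
  injective_j (s : ℕ) : Function.Injective (j s 0)
  subsingleton_D (t : ℕ) : Subsingleton (D (0, t))

namespace ExactCouple

attribute [instance] ExactCouple.grpD ExactCouple.grpE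

variable (K : ExactCouple.{w})

/-- The map `i`, as an endomorphism of the product of all the groups `D (s, t)`. -/
def I : AddMonoid.End (∀ p, K.D p) where
  toFun y
    | (_, 0) => 0
    | (s, t + 1) => K.i s t (y (s + 1, t))
  map_zero' := by
    funext ⟨s, t⟩
    cases t <;> simp
  map_add' y y' := by
    funext ⟨s, t⟩
    cases t <;> simp

/-- The map `k` out of `E p`, into the product of all the groups `D (s, t)`. -/
def kTot (p : ℕ × ℕ) : K.E p →+ (∀ q, K.D q) :=
  (AddMonoidHom.single K.D (p.1 + 1, p.2)).comp (K.k p.1 p.2)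

/-- The cycles of the page `n + 1`: the `x` such that `k x` is in the image of `i ^ n`. -/
def Z (n : ℕ) (p : ℕ × ℕ) : AddSubgroup (K.E p) :=
  (AddMonoidHom.range (K.I ^ n : AddMonoid.End (∀ p, K.D p))).comap (K.kTot p)

/-- The boundaries of the page `n + 1`: the image under `j` of the kernel of `i ^ n`. -/
def B (n : ℕ) (p : ℕ × ℕ) : AddSubgroup (K.E p) :=
  ((AddMonoidHom.ker (K.I ^ n : AddMonoid.End (∀ p, K.D p))).comap
    (AddMonoidHom.single K.D p)).map (K.j p.1 p.2)

lemma mem_Z {n : ℕ} {p : ℕ × ℕ} {x : K.E p} :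
    x ∈ K.Z n p ↔ ∃ y, (K.I ^ n) y = Pi.single (p.1 + 1, p.2) (K.k p.1 p.2 x) := Iff.rfl

lemma mem_B {n : ℕ} {p : ℕ × ℕ} {x : K.E p} :
    x ∈ K.B n p ↔ ∃ y : K.D p, (K.I ^ n) (Pi.single p y) = 0 ∧ K.j p.1 p.2 y = x := Iff.rfl

lemma I_zero (y : ∀ p, K.D p) (s : ℕ) : K.I y (s, 0) = 0 := rfl

lemma I_succ (y : ∀ p, K.D p) (s t : ℕ) : K.I y (s, t + 1) = K.i s t (y (s + 1, t)) := rfl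

lemma pow_succ_apply (n : ℕ) (y : ∀ p, K.D p) : (K.I ^ (n + 1)) y = (K.I ^ n) (K.I y) := by
  rw [pow_succ]; rfl

lemma pow_succ_apply' (n : ℕ) (y : ∀ p, K.D p) : (K.I ^ (n + 1)) y = K.I ((K.I ^ n) y) := by
  rw [pow_succ']; rfl

lemma I_single (s t : ℕ) (v : K.D (s + 1, t)) :
    K.I (Pi.single (s + 1, t) v) = Pi.single (s, t + 1) (K.i s t v) := by
  funext ⟨s', t'⟩
  cases t' with
  | zero => rw [I_zero, Pi.single_eq_of_ne (by simp)]
  | succ t' =>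
    rw [I_succ]
    by_cases h : s' = s ∧ t' = t
    · obtain ⟨rfl, rfl⟩ := h
      simp
    · rw [Pi.single_eq_of_ne (by simpa using h), Pi.single_eq_of_ne (by simpa using h), map_zero]

lemma I_single_zero (t : ℕ) (v : K.D (0, t)) : K.I (Pi.single (0, t) v) = 0 := by
  have := K.subsingleton_D t
  rw [Subsingleton.elim v 0, Pi.single_zero, map_zero]

/-- An `n`-fold lift of a homogeneous element can be chosen homogeneous. -/
lemma pow_homogeneous (n : ℕ) : ∀ (y : ∀ p, K.D p) (s t t' : ℕ) (v : K.D (s, t)) (_ : t = t' + n)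
    (_ : (K.I ^ n) y = Pi.single (s, t) v),
    (K.I ^ n) (Pi.single (s + n, t') (y (s + n, t'))) = Pi.single (s, t) v := by
  induction n with
  | zero =>
    intro y s t t' v ht hy
    obtain rfl : t = t' := ht
    obtain rfl : y = Pi.single (s, t) v := hy
    simp
  | succ n ih =>
    intro y s t t' v ht hy
    rw [pow_succ_apply] at hy
    have := ih (K.I y) s t (t' + 1) v (by omega) hy
    rw [I_succ, ← I_single, ← pow_succ_apply] at this
    exact this

lemma eq_zero_of_pow (n : ℕ) : ∀ (y : ∀ p, K.D p) (s t : ℕ) (v : K.D (s, t)) (_ : t < n)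
    (_ : (K.I ^ n) y = Pi.single (s, t) v), v = 0 := by
  induction n with
  | zero => intro y s t v ht; omega
  | succ n ih =>
    intro y s t v ht hy
    obtain _ | t := t
    · rw [pow_succ_apply'] at hy
      have := congrFun hy (s, 0)
      rw [I_zero, Pi.single_eq_same] at this
      exact this.symm
    · rw [pow_succ_apply] at hy
      by_cases h : t + 1 < n
      · exact ih _ s (t + 1) v h hy
      · obtain rfl : n = t + 1 := by omega
        have := K.pow_homogeneous (t + 1) (K.I y) s (t + 1) 0 v (by omega) hy
        rw [I_zero, Pi.single_zero, map_zero] at this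
        simpa using this.symm

/-- The iterate `i ^ n` on a homogeneous element is homogeneous. -/
lemma exists_pow_single (n : ℕ) : ∀ (s t : ℕ) (v : K.D (s + n, t)),
    ∃ z : K.D (s, t + n), (K.I ^ n) (Pi.single (s + n, t) v) = Pi.single (s, t + n) z := by
  induction n with
  | zero => intro s t v; exact ⟨v, rfl⟩
  | succ n ih =>
    intro s t v
    obtain ⟨z, hz⟩ := ih s (t + 1) (K.i (s + n) t v)
    have e : (s, t + 1 + n) = (s, t + (n + 1)) := by ext <;> simp; omega
    rw [pow_succ_apply]
    have h2 : K.I (Pi.single (s + (n + 1), t) v) = Pi.single (s + n, t + 1) (K.i (s + n) t v) :=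
      K.I_single (s + n) t v
    rw [h2, hz]
    clear hz h2
    revert z
    rw [e]
    intro z
    exact ⟨z, rfl⟩

lemma pow_single_eq_zero (n : ℕ) : ∀ (s t : ℕ) (_ : s < n) (v : K.D (s, t)),
    (K.I ^ n) (Pi.single (s, t) v) = 0 := by
  induction n with
  | zero => intro s t h; omega
  | succ n ih =>
    intro s t h v
    rw [pow_succ_apply]
    obtain _ | s := s
    · rw [I_single_zero, map_zero]
    · rw [I_single, ih _ _ (by omega)]

lemma kj (s t : ℕ) (y : K.D (s, t)) : K.k s t (K.j s t y) = 0 :=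
  (K.exact_jk s t).apply_apply_eq_zero y

lemma j_mem_Z (n : ℕ) {p : ℕ × ℕ} (y : K.D p) : K.j p.1 p.2 y ∈ K.Z n p :=
  K.mem_Z.2 ⟨0, by rw [kj, map_zero, Pi.single_zero]⟩

lemma B_le_Z (n : ℕ) (p : ℕ × ℕ) : K.B n p ≤ K.Z n p := by
  rintro _ ⟨y, -, rfl⟩
  exact K.j_mem_Z n y

lemma Z_anti (n : ℕ) (p : ℕ × ℕ) : K.Z (n + 1) p ≤ K.Z n p := by
  intro x hx
  obtain ⟨y, hy⟩ := K.mem_Z.1 hx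
  exact K.mem_Z.2 ⟨K.I y, by rw [← pow_succ_apply, hy]⟩

lemma B_mono (n : ℕ) (p : ℕ × ℕ) : K.B n p ≤ K.B (n + 1) p := by
  intro x hx
  obtain ⟨y, hy, rfl⟩ := K.mem_B.1 hx
  exact K.mem_B.2 ⟨y, by rw [pow_succ_apply', hy, map_zero], rfl⟩

/-- The term of bidegree `p` on the page `n + 1`. -/
abbrev Page (n : ℕ) (p : ℕ × ℕ) : Type w := K.Z n p ⧸ (K.B n p).addSubgroupOf (K.Z n p)

/-- The class on the page `n + 1` of a cycle. -/
abbrev cls (n : ℕ) (p : ℕ × ℕ) : K.Z n p →+ K.Page n p := QuotientAddGroup.mk' _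

lemma cls_eq_zero {n : ℕ} {p : ℕ × ℕ} {x : K.Z n p} : K.cls n p x = 0 ↔ (x : K.E p) ∈ K.B n p :=
  QuotientAddGroup.eq_zero_iff x

/-- On the first page every element is a cycle. -/
lemma Z_zero (p : ℕ × ℕ) : K.Z 0 p = ⊤ :=
  eq_top_iff.2 fun _ _ ↦ K.mem_Z.2 ⟨_, rfl⟩

/-- On the first page only `0` is a boundary, so that the term of bidegree `p` is `E p`. -/
lemma B_zero (p : ℕ × ℕ) : K.B 0 p = ⊥ := by
  rw [eq_bot_iff]
  rintro x ⟨y, hy, rfl⟩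
  have hy : Pi.single p y = (0 : ∀ p, K.D p) := hy
  rw [Pi.single_eq_zero_iff] at hy
  rw [hy, map_zero]
  exact zero_mem _

/-- The bidegrees `a`, `b` with `b = a + (n + 1, -n)`. -/
def Rel (n : ℕ) (a b : ℕ × ℕ) : Prop := a.1 + (n + 1) = b.1 ∧ b.2 + n = a.2

variable {K} in
lemma exists_lift {n : ℕ} {a b : ℕ × ℕ} (h : Rel n a b) (x : K.Z n a) :
    ∃ y : K.D b, (K.I ^ n) (Pi.single b y) = K.kTot a x := by
  obtain ⟨y, hy⟩ := K.mem_Z.1 x.2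
  obtain ⟨a1, a2⟩ := a
  obtain ⟨b1, b2⟩ := b
  obtain ⟨h1, h2⟩ := h
  dsimp only at h1 h2
  obtain rfl : b1 = a1 + 1 + n := by omega
  exact ⟨_, K.pow_homogeneous n y _ _ b2 _ h2.symm hy⟩

/-- Well-definedness of the differential: two lifts differ by a boundary. -/
lemma cls_lift_eq {n : ℕ} {b : ℕ × ℕ} {y y' : K.D b}
    (h : (K.I ^ n) (Pi.single b y) = (K.I ^ n) (Pi.single b y')) :
    K.cls n b ⟨_, K.j_mem_Z n y⟩ = K.cls n b ⟨_, K.j_mem_Z n y'⟩ := by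
  rw [← sub_eq_zero, ← map_sub, cls_eq_zero]
  refine K.mem_B.2 ⟨y - y', ?_, by simp⟩
  rw [Pi.single_sub, map_sub, h, sub_self]

/-- The differential of the page `n + 1` on cycles: `x ↦ j y`, where `i ^ n y = k x`. -/
def dZ {n : ℕ} {a b : ℕ × ℕ} (h : Rel n a b) : K.Z n a →+ K.Page n b :=
  AddMonoidHom.mk' (fun x ↦ K.cls n b ⟨_, K.j_mem_Z n (exists_lift h x).choose⟩) (fun x x' ↦ by
    rw [← map_add]
    refine Eq.trans (K.cls_lift_eq (y' := (exists_lift h x).choose + (exists_lift h x').choose) ?_)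
      (congrArg _ (Subtype.ext (by simp)))
    rw [(exists_lift h (x + x')).choose_spec, Pi.single_add, map_add,
      (exists_lift h x).choose_spec, (exists_lift h x').choose_spec]
    simp)

lemma dZ_eq {n : ℕ} {a b : ℕ × ℕ} (h : Rel n a b) (x : K.Z n a) (y : K.D b)
    (hy : (K.I ^ n) (Pi.single b y) = K.kTot a x) :
    K.dZ h x = K.cls n b ⟨_, K.j_mem_Z n y⟩ :=
  K.cls_lift_eq (by rw [hy]; exact (exists_lift h x).choose_spec)

lemma dZ_j {n : ℕ} {a b : ℕ × ℕ} (h : Rel n a b) (y : K.D a) :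
    K.dZ h ⟨_, K.j_mem_Z n y⟩ = 0 := by
  have hk : K.kTot a (K.j a.1 a.2 y) = 0 := by
    change Pi.single (a.1 + 1, a.2) (K.k a.1 a.2 (K.j a.1 a.2 y)) = 0
    rw [kj, Pi.single_zero]
  rw [K.dZ_eq h _ 0 (by rw [hk, Pi.single_zero, map_zero]), cls_eq_zero]
  simp [zero_mem]

/-- The differential of the page `n + 1`, of bidegree `(n + 1, -n)`. -/
def d {n : ℕ} {a b : ℕ × ℕ} (h : Rel n a b) : K.Page n a →+ K.Page n b :=
  QuotientAddGroup.lift _ (K.dZ h) (fun x hx ↦ by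
    obtain ⟨y, -, hy⟩ := K.mem_B.1 (AddSubgroup.mem_addSubgroupOf.1 hx)
    obtain rfl : x = ⟨_, K.j_mem_Z n y⟩ := Subtype.ext hy.symm
    exact K.dZ_j h y)

lemma d_cls {n : ℕ} {a b : ℕ × ℕ} (h : Rel n a b) (x : K.Z n a) :
    K.d h (K.cls n a x) = K.dZ h x := rfl

lemma d_comp_d {n : ℕ} {a b c : ℕ × ℕ} (h : Rel n a b) (h' : Rel n b c) (x : K.Page n a) :
    K.d h' (K.d h x) = 0 := by
  obtain ⟨x, rfl⟩ := QuotientAddGroup.mk'_surjective _ x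
  exact K.dZ_j h' _

lemma d_cls_eq_zero {n : ℕ} {a b : ℕ × ℕ} (h : Rel n a b) (x : K.Z n a) :
    K.d h (K.cls n a x) = 0 ↔ (x : K.E a) ∈ K.Z (n + 1) a := by
  obtain ⟨y, hy⟩ := exists_lift h x
  rw [d_cls, K.dZ_eq h x y hy, cls_eq_zero]
  constructor
  · intro hB
    obtain ⟨w, hw, hw'⟩ := K.mem_B.1 hB
    obtain ⟨b1, b2⟩ := b
    have hj : K.j b1 b2 (y - w) = 0 := by
      rw [map_sub, sub_eq_zero]; exact hw'.symm
    suffices h3 : ∃ v, K.I v = Pi.single (b1, b2) (y - w) by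
      obtain ⟨v, hv⟩ := h3
      refine K.mem_Z.2 ⟨v, ?_⟩
      rw [pow_succ_apply, hv, Pi.single_sub, map_sub, hw, sub_zero, hy]
      rfl
    obtain _ | b2 := b2
    · refine ⟨0, ?_⟩
      rw [K.injective_j b1 (hj.trans (map_zero _).symm)]
      simp
    · obtain ⟨v, hv⟩ := (K.exact_ij b1 b2 _).1 hj
      exact ⟨Pi.single (b1 + 1, b2) v, by rw [I_single, hv]⟩
  · intro hx
    obtain ⟨v, hv⟩ := K.mem_Z.1 hx
    rw [pow_succ_apply] at hv
    obtain ⟨a1, a2⟩ := a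
    obtain ⟨b1, b2⟩ := b
    obtain ⟨h1, h2⟩ := h
    dsimp only at h1 h2
    obtain rfl : b1 = a1 + 1 + n := by omega
    have h4 := K.pow_homogeneous n _ _ _ b2 _ h2.symm hv
    refine K.mem_B.2 ⟨y - (K.I v) (a1 + 1 + n, b2), ?_, ?_⟩
    · rw [Pi.single_sub, map_sub, h4, hy, sub_eq_zero]
      rfl
    · rw [map_sub, sub_eq_self]
      obtain _ | b2 := b2
      · rw [I_zero, map_zero]
      · rw [I_succ]
        exact (K.exact_ij _ _).apply_apply_eq_zero _

lemma Z_succ_eq {n : ℕ} {a : ℕ × ℕ} (h : a.2 < n) (x : K.Z n a) : (x : K.E a) ∈ K.Z (n + 1) a := by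
  obtain ⟨y, hy⟩ := K.mem_Z.1 x.2
  exact K.mem_Z.2 ⟨0, by rw [K.eq_zero_of_pow n y _ _ _ h hy]; simp⟩

lemma mem_range_d {n : ℕ} {a b : ℕ × ℕ} (h : Rel n a b) (x : K.Z n b) :
    K.cls n b x ∈ (K.d h).range ↔ (x : K.E b) ∈ K.B (n + 1) b := by
  constructor
  · rintro ⟨z, hz⟩
    obtain ⟨z, rfl⟩ := QuotientAddGroup.mk'_surjective _ z
    obtain ⟨y, hy⟩ := exists_lift h z
    have hz : K.d h (K.cls n a z) = K.cls n b x := hz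
    rw [d_cls, K.dZ_eq h z y hy, ← sub_eq_zero, ← map_sub, cls_eq_zero] at hz
    have h1 := K.B_mono n b hz
    have h2 : K.j b.1 b.2 y ∈ K.B (n + 1) b := by
      refine K.mem_B.2 ⟨y, ?_, rfl⟩
      rw [pow_succ_apply', hy]
      change K.I (Pi.single (a.1 + 1, a.2) _) = 0
      rw [I_single, (K.exact_ki _ _).apply_apply_eq_zero, Pi.single_zero]
    simpa using sub_mem h2 h1
  · intro hx
    obtain ⟨y, hy, hyx⟩ := K.mem_B.1 hx
    obtain ⟨a1, a2⟩ := a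
    obtain ⟨b1, b2⟩ := b
    obtain ⟨h1, h2⟩ := id h
    dsimp only at h1 h2
    obtain rfl : b1 = a1 + 1 + n := by omega
    obtain rfl : a2 = b2 + n := by omega
    obtain ⟨z, hz⟩ := K.exists_pow_single n (a1 + 1) b2 y
    rw [pow_succ_apply', hz, I_single, Pi.single_eq_zero_iff] at hy
    obtain ⟨e, rfl⟩ := (K.exact_ki _ _ _).1 hy
    let e' : K.Z n (a1, b2 + n) := ⟨e, K.mem_Z.2 ⟨_, hz⟩⟩
    refine ⟨K.cls n _ e', ?_⟩
    rw [d_cls, K.dZ_eq h e' y hz]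
    exact congrArg _ (Subtype.ext hyx)

lemma mem_B_succ_of_le {n : ℕ} {b : ℕ × ℕ} (h : b.1 ≤ n) (x : K.E b) :
    x ∈ K.B n b ↔ x ∈ K.B (n + 1) b := by
  refine ⟨fun hx ↦ K.B_mono n b hx, fun hx ↦ ?_⟩
  obtain ⟨y, hy, rfl⟩ := K.mem_B.1 hx
  refine K.mem_B.2 ⟨y, ?_, rfl⟩
  obtain ⟨b1, b2⟩ := b
  dsimp only at h
  obtain h | rfl := h.lt_or_eq
  · exact K.pow_single_eq_zero _ _ _ h y
  · have key : ∀ (m : ℕ) (_ : m = 0 + b1) (y : K.D (m, b2)),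
        (K.I ^ b1) (Pi.single (m, b2) y) = 0 := by
      rintro _ rfl y
      obtain ⟨z, hz⟩ := K.exists_pow_single b1 0 b2 y
      have := K.subsingleton_D (b2 + b1)
      rw [hz, Subsingleton.elim z 0, Pi.single_zero]
    exact key b1 (by omega) y

/-- The complex shape of the differentials of bidegree `(n + 1, -n)` in the first quadrant is
the relation `Rel n`. -/
lemma rel_iff {r : ℤ} (n : ℕ) (hr : r = n + 1) (a b : ℕ × ℕ) :
    (ComplexShape.spectralSequenceNat ⟨r, 1 - r⟩).Rel a b ↔ Rel n a b := by
  subst hr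
  simp only [ComplexShape.spectralSequenceNat_rel_iff, Rel]
  omega

open scoped Classical in
/-- The page `n + 1`, as a complex of abelian groups. -/
def pageComplex (n : ℕ) (r : ℤ) (hr : r = n + 1) :
    HomologicalComplex AddCommGrpCat.{w} (ComplexShape.spectralSequenceNat ⟨r, 1 - r⟩) where
  X p := AddCommGrpCat.of (K.Page n p)
  d a b := if h : Rel n a b then AddCommGrpCat.ofHom (K.d h) else 0
  shape a b h := dif_neg (fun h' ↦ h ((rel_iff n hr a b).2 h'))
  d_comp_d' a b c h h' := by
    rw [dif_pos ((rel_iff n hr a b).1 h), dif_pos ((rel_iff n hr b c).1 h')]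
    refine AddCommGrpCat.hom_ext (AddMonoidHom.ext fun x ↦ ?_)
    exact K.d_comp_d _ _ x

lemma pageComplex_d {n : ℕ} {r : ℤ} (hr : r = n + 1) {a b : ℕ × ℕ} (h : Rel n a b) :
    (K.pageComplex n r hr).d a b = AddCommGrpCat.ofHom (K.d h) := dif_pos h

lemma pageComplex_d_eq_zero {n : ℕ} {r : ℤ} (hr : r = n + 1) {a b : ℕ × ℕ} (h : ¬ Rel n a b) :
    (K.pageComplex n r hr).d a b = 0 := dif_neg h

lemma pageComplex_ker {n : ℕ} {r : ℤ} (hr : r = n + 1) (p : ℕ × ℕ) (x : K.Z n p) :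
    ((K.pageComplex n r hr).sc p).g.hom (K.cls n p x) = 0 ↔ (x : K.E p) ∈ K.Z (n + 1) p := by
  by_cases h : n ≤ p.2
  · have h' : Rel n p (p.1 + (n + 1), p.2 - n) := ⟨rfl, by simp; omega⟩
    have e := ComplexShape.next_eq' _ ((rel_iff n hr _ _).2 h')
    change ((K.pageComplex n r hr).d p _).hom (K.cls n p x) = 0 ↔ _
    rw [e, K.pageComplex_d hr h']
    exact K.d_cls_eq_zero h' x
  · have h' : ¬ Rel n p ((ComplexShape.spectralSequenceNat ⟨r, 1 - r⟩).next p) := by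
      rintro ⟨-, h2⟩
      omega
    change ((K.pageComplex n r hr).d p _).hom (K.cls n p x) = 0 ↔ _
    rw [K.pageComplex_d_eq_zero hr h']
    exact ⟨fun _ ↦ K.Z_succ_eq (by omega) x, fun _ ↦ rfl⟩

lemma pageComplex_range {n : ℕ} {r : ℤ} (hr : r = n + 1) (p : ℕ × ℕ) (x : K.Z n p) :
    (∃ z, ((K.pageComplex n r hr).sc p).f.hom z = K.cls n p x) ↔
      (x : K.E p) ∈ K.B (n + 1) p := by
  by_cases h : n + 1 ≤ p.1
  · have h' : Rel n (p.1 - (n + 1), p.2 + n) p := ⟨by simp; omega, rfl⟩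
    have e := ComplexShape.prev_eq' _ ((rel_iff n hr _ _).2 h')
    change (∃ z, ((K.pageComplex n r hr).d _ p).hom z = K.cls n p x) ↔ _
    rw [e, K.pageComplex_d hr h']
    exact K.mem_range_d h' x
  · have h' : ¬ Rel n ((ComplexShape.spectralSequenceNat ⟨r, 1 - r⟩).prev p) p := by
      rintro ⟨h1, -⟩
      omega
    change (∃ z, ((K.pageComplex n r hr).d _ p).hom z = K.cls n p x) ↔ _
    rw [K.pageComplex_d_eq_zero hr h', ← K.mem_B_succ_of_le (by omega), ← K.cls_eq_zero]
    exact ⟨fun ⟨_, hz⟩ ↦ hz.symm, fun hz ↦ ⟨0, hz.symm⟩⟩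

/-- The map from the cycles of the page `n + 2` to the homology of the page `n + 1`. -/
def toHomology (n : ℕ) (r : ℤ) (hr : r = n + 1) (p : ℕ × ℕ) :
    K.Z (n + 1) p →+ (AddMonoidHom.ker ((K.pageComplex n r hr).sc p).g.hom ⧸
      AddMonoidHom.range ((K.pageComplex n r hr).sc p).abToCycles) :=
  (QuotientAddGroup.mk' _).comp
    (((K.cls n p).comp (AddSubgroup.inclusion (K.Z_anti n p))).codRestrict _
      (fun x ↦ (K.pageComplex_ker hr p _).2 x.2))

lemma toHomology_surjective (n : ℕ) (r : ℤ) (hr : r = n + 1) (p : ℕ × ℕ) :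
    Function.Surjective (K.toHomology n r hr p) := by
  intro z
  obtain ⟨⟨z, hz⟩, rfl⟩ := QuotientAddGroup.mk'_surjective _ z
  obtain ⟨x, rfl⟩ := QuotientAddGroup.mk'_surjective _ z
  exact ⟨⟨x, (K.pageComplex_ker hr p x).1 hz⟩, rfl⟩

lemma toHomology_ker (n : ℕ) (r : ℤ) (hr : r = n + 1) (p : ℕ × ℕ) :
    (K.toHomology n r hr p).ker = (K.B (n + 1) p).addSubgroupOf (K.Z (n + 1) p) := by
  ext x
  rw [AddSubgroup.mem_addSubgroupOf]
  refine Iff.trans ?_ (K.pageComplex_range hr p (AddSubgroup.inclusion (K.Z_anti n p) x))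
  refine (QuotientAddGroup.eq_zero_iff _).trans ?_
  exact exists_congr (fun z ↦ Subtype.ext_iff)

/-- The homology of the page `n + 1` is the page `n + 2`. -/
def pageIso (n : ℕ) (r : ℤ) (hr : r = n + 1) (p : ℕ × ℕ) :
    (K.pageComplex n r hr).homology p ≅ AddCommGrpCat.of (K.Page (n + 1) p) :=
  ((K.pageComplex n r hr).sc p).abHomologyIso ≪≫
    (AddEquiv.toAddCommGrpIso
      ((QuotientAddGroup.quotientAddEquivOfEq (K.toHomology_ker n r hr p).symm).trans
        (QuotientAddGroup.quotientKerEquivOfSurjective _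
          (K.toHomology_surjective n r hr p)))).symm

/-- The spectral sequence of an exact couple. -/
def spectralSequence : CohomologicalSpectralSequenceNat AddCommGrpCat.{w} 1 where
  page r hr := K.pageComplex (r - 1).toNat r (by omega)
  iso r r' p hrr' hr :=
    K.pageIso (r - 1).toNat r (by omega) p ≪≫
      eqToIso (by
        have : (r' - 1).toNat = (r - 1).toNat + 1 := by omega
        dsimp only [pageComplex]
        rw [this])

end ExactCouple

/-- A resolution `⋯ → U 1 → U 0 → 0`, spliced from short exact sequences
`0 → V (s + 1) → U s → V s → 0` with `V 0 = 0`. -/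
structure SplicedResolution (C : Type u) [Category.{v} C] [Abelian C] where
  U : ℕ → C
  V : ℕ → C
  ι (s : ℕ) : V (s + 1) ⟶ U s
  π (s : ℕ) : U s ⟶ V s
  zero (s : ℕ) : ι s ≫ π s = 0
  shortExact (s : ℕ) : (ShortComplex.mk (ι s) (π s) (zero s)).ShortExact
  isZero : IsZero (V 0)

namespace SplicedResolution

variable {C : Type u} [Category.{v} C] [Abelian C] [HasExt.{w} C]

lemma subsingleton_ext {Z : C} (hZ : IsZero Z) (X : C) (t : ℕ) : Subsingleton (Ext.{w} Z X t) := by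
  refine ⟨fun x y ↦ ?_⟩
  rw [← Ext.mk₀_id_comp x, ← Ext.mk₀_id_comp y, hZ.eq_of_src (𝟙 Z) 0]
  simp

/-- The exact couple made of the long exact sequences of `Ext^t(-, X)` attached to the short
exact sequences of a spliced resolution. -/
def exactCouple (R : SplicedResolution C) (X : C) : ExactCouple.{w} where
  D p := Ext.{w} (R.V p.1) X p.2
  E p := Ext.{w} (R.U p.1) X p.2
  i s t := (R.shortExact s).extClass.precomp X (add_comm 1 t)
  j s t := (Ext.mk₀ (R.π s)).precomp X (zero_add t)
  k s t := (Ext.mk₀ (R.ι s)).precomp X (zero_add t)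
  exact_jk s t := (ShortComplex.ab_exact_iff_function_exact _).1
    (Ext.contravariant_sequence_exact₂' (R.shortExact s) X t)
  exact_ki s t := (ShortComplex.ab_exact_iff_function_exact _).1
    (Ext.contravariant_sequence_exact₁' (R.shortExact s) X t (t + 1) (add_comm 1 t))
  exact_ij s t := (ShortComplex.ab_exact_iff_function_exact _).1
    (Ext.contravariant_sequence_exact₃' (R.shortExact s) X t (t + 1) (add_comm 1 t))
  injective_j s := by
    have : Epi (R.π s) := (R.shortExact s).epi_g
    exact Ext.precomp_mk₀_injective_of_epi X (R.π s)
  subsingleton_D t := subsingleton_ext R.isZero X t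

/-- The resolution spectral sequence
`E_1^{s,t} = Ext^t(U s, X)`, `d_r : E_r^{s,t} → E_r^{s+r,t-r+1}`. -/
def spectralSequence (R : SplicedResolution C) (X : C) :
    CohomologicalSpectralSequenceNat AddCommGrpCat.{w} 1 :=
  (R.exactCouple X).spectralSequence

end SplicedResolution

/-- An additive functor `F : D ⥤ C` is resolving if every object of `D` is a quotient of a
projective object which `F` sends to a projective object. -/
def IsResolving {C : Type u} [Category.{v} C] {D : Type u₂} [Category.{v₂} D] (F : D ⥤ C) : Prop :=
  ∀ X : D, ∃ (P : D) (p : P ⟶ X), Projective P ∧ Projective (F.obj P) ∧ Epi p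

section RelativeNotions

variable {C : Type u} [Category.{v} C] [Abelian C]

/-- `J` is injective relative to the class `W` of short exact sequences. -/
def IsRelInjective (W : ShortComplex C → Prop) (J : C) : Prop :=
  ∀ S : ShortComplex C, W S → ∀ f : S.X₁ ⟶ J, ∃ g : S.X₂ ⟶ J, S.f ≫ g = f

/-- Every object `X` admits a short exact sequence `0 → X → J → Q → 0` in the class `W` with `J`
injective relative to `W`. -/
def EnoughRelInjectives (W : ShortComplex C → Prop) : Prop :=
  ∀ X : C, ∃ S : ShortComplex C, W S ∧ Nonempty (S.X₁ ≅ X) ∧ IsRelInjective W S.X₂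

/-- A contravariant functor `T` is left exact relative to the class `W` if it sends every
`0 → A → B → Q → 0` in `W` to an exact sequence `0 → T Q → T B → T A`. -/
def IsLeftRelExact (W : ShortComplex C → Prop) (T : Cᵒᵖ ⥤ AddCommGrpCat.{w}) : Prop :=
  ∀ S : ShortComplex C, W S →
    Function.Injective (T.map S.g.op) ∧ Function.Exact (T.map S.g.op) (T.map S.f.op)

end RelativeNotions

namespace CompatibleSplitting

open scoped ZeroObject

attribute [local instance] Abelian.hasFiniteBiproducts

variable {C : Type u} [Category.{v} C] [Abelian C] {I : Type u₁} [Finite I]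
  {D : I → Type u₂} [∀ i, Category.{v₂} (D i)]
  {F : ∀ i, D i ⥤ C} {G : ∀ i, C ⥤ D i}

/-- The functor `∏ D i ⥤ C` sending `(X i)` to `⨁ F i (X i)`. -/
@[simps]
def sumFunctor (F : ∀ i, D i ⥤ C) : (∀ i, D i) ⥤ C where
  obj X := ⨁ fun i ↦ (F i).obj (X i)
  map f := biproduct.map fun i ↦ (F i).map (f i)

/-- The bijection `Hom(⨁ F i (X i), Y) ≃ ∏ Hom(X i, G i Y)`. -/
def sumHomEquiv (adj : ∀ i, F i ⊣ G i) (X : ∀ i, D i) (Y : C) :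
    ((⨁ fun i ↦ (F i).obj (X i)) ⟶ Y) ≃ (∀ i, X i ⟶ (G i).obj Y) where
  toFun f i := (adj i).homEquiv _ _ (biproduct.ι (fun i ↦ (F i).obj (X i)) i ≫ f)
  invFun g := biproduct.desc fun i ↦ ((adj i).homEquiv _ _).symm (g i)
  left_inv f := by
    apply biproduct.hom_ext'
    intro i
    simp
  right_inv g := by
    funext i
    simp

lemma ι_sumHomEquiv_symm (adj : ∀ i, F i ⊣ G i) (X : ∀ i, D i) (Y : C)
    (g : ∀ i, X i ⟶ (G i).obj Y) (i : I) :
    biproduct.ι (fun i ↦ (F i).obj (X i)) i ≫ (sumHomEquiv adj X Y).symm g =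
      ((adj i).homEquiv _ _).symm (g i) :=
  biproduct.ι_desc _ _

lemma sumHomEquiv_naturality_left_symm (adj : ∀ i, F i ⊣ G i) {X' X : ∀ i, D i} {Y : C}
    (f : ∀ i, X' i ⟶ X i) (g : ∀ i, X i ⟶ (G i).obj Y) :
    (sumHomEquiv adj X' Y).symm (fun i ↦ f i ≫ g i) =
      biproduct.map (fun i ↦ (F i).map (f i)) ≫ (sumHomEquiv adj X Y).symm g := by
  apply biproduct.hom_ext'
  intro i
  rw [ι_sumHomEquiv_symm, biproduct.ι_map_assoc, ι_sumHomEquiv_symm,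
    Adjunction.homEquiv_naturality_left_symm]

lemma sumHomEquiv_naturality_right (adj : ∀ i, F i ⊣ G i) {X : ∀ i, D i} {Y Y' : C}
    (f : (⨁ fun i ↦ (F i).obj (X i)) ⟶ Y) (g : Y ⟶ Y') (i : I) :
    sumHomEquiv adj X Y' (f ≫ g) i = sumHomEquiv adj X Y f i ≫ (G i).map g := by
  simp only [sumHomEquiv, Equiv.coe_fn_mk, Adjunction.homEquiv_naturality_right,
    Functor.map_comp, Category.assoc]

/-- The functor `sumFunctor F` is left adjoint to the functor `C ⥤ ∏ D i` with components `G i`. -/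
def adjunction (adj : ∀ i, F i ⊣ G i) : sumFunctor F ⊣ Functor.pi' G :=
  Adjunction.mkOfHomEquiv
    { homEquiv := sumHomEquiv adj
      homEquiv_naturality_left_symm f g := sumHomEquiv_naturality_left_symm adj f g
      homEquiv_naturality_right f g := funext (sumHomEquiv_naturality_right adj f g) }

/-- The endofunctor `FG` of `C`, sending `Y` to `⨁ F i (G i Y)`. -/
abbrev FG (F : ∀ i, D i ⥤ C) (G : ∀ i, C ⥤ D i) : C ⥤ C := Functor.pi' G ⋙ sumFunctor F

/-- The counit `ε_Y : FG Y ⟶ Y`. -/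
def ε (adj : ∀ i, F i ⊣ G i) (Y : C) : (FG F G).obj Y ⟶ Y := (adjunction adj).counit.app Y

lemma ι_ε (adj : ∀ i, F i ⊣ G i) (Y : C) (i : I) :
    biproduct.ι (fun i ↦ (F i).obj ((G i).obj Y)) i ≫ ε adj Y = (adj i).counit.app Y := by
  refine (ι_sumHomEquiv_symm adj _ Y (fun i ↦ 𝟙 ((G i).obj Y)) i).trans ?_
  exact (adj i).homEquiv_symm_id Y

instance [Nonempty I] [∀ i, (G i).Faithful] (adj : ∀ i, F i ⊣ G i) (Y : C) : Epi (ε adj Y) := by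
  obtain ⟨i⟩ := ‹Nonempty I›
  have : Epi (biproduct.ι (fun i ↦ (F i).obj ((G i).obj Y)) i ≫ ε adj Y) := by
    rw [ι_ε]
    infer_instance
  exact epi_of_epi (biproduct.ι (fun i ↦ (F i).obj ((G i).obj Y)) i) _

/-- The sequence `0 → ker ε_Y → FG Y → Y → 0`. -/
@[simps]
def counitSequence (adj : ∀ i, F i ⊣ G i) (Y : C) : ShortComplex C :=
  ShortComplex.mk (kernel.ι (ε adj Y)) (ε adj Y) (kernel.condition _)

lemma counitSequence_shortExact [Nonempty I] [∀ i, (G i).Faithful] (adj : ∀ i, F i ⊣ G i) (Y : C) :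
    (counitSequence adj Y).ShortExact where
  exact := ShortComplex.exact_kernel _
  mono_f := inferInstanceAs (Mono (kernel.ι (ε adj Y)))
  epi_g := inferInstanceAs (Epi (ε adj Y))

/-- The class `E` of the sequences `0 → ker ε_Y → FG Y → Y → 0`, up to isomorphism. -/
def counitClass (adj : ∀ i, F i ⊣ G i) (S : ShortComplex C) : Prop :=
  ∃ Y : C, Nonempty (S ≅ counitSequence adj Y)

/-- The class of the short exact sequences of `C` which are split by each of the functors `G i`. -/
def splitClass (G : ∀ i, C ⥤ D i) (S : ShortComplex C) : Prop :=
  S.ShortExact ∧ ∀ i, IsSplitEpi ((G i).map S.g)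

/-- The iterated kernels `Y`, `ker ε_Y`, `ker ε_{ker ε_Y}`, etc. -/
def syzygy (adj : ∀ i, F i ⊣ G i) (Y : C) : ℕ → C
  | 0 => Y
  | n + 1 => kernel (ε adj (syzygy adj Y n))

/-- The exact sequence `⋯ → FG (ker ε_Y) → FG Y → Y → 0`: one has `U 0 = V 1 = Y`,
`U s = FG (V s)` for `s ≥ 1`, and `V (s + 1)` is the kernel of `ε : U s ⟶ V s` for `s ≥ 1`. -/
def resolution [Nonempty I] [∀ i, (G i).Faithful] (adj : ∀ i, F i ⊣ G i) (Y : C) :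
    SplicedResolution C where
  U
    | 0 => Y
    | s + 1 => (FG F G).obj (syzygy adj Y s)
  V
    | 0 => 0
    | s + 1 => syzygy adj Y s
  ι
    | 0 => 𝟙 Y
    | s + 1 => kernel.ι (ε adj (syzygy adj Y s))
  π
    | 0 => 0
    | s + 1 => ε adj (syzygy adj Y s)
  zero
    | 0 => comp_zero
    | _ + 1 => kernel.condition _
  shortExact
    | 0 =>
      { exact := (ShortComplex.exact_iff_epi _ rfl).2 (inferInstanceAs (Epi (𝟙 Y)))
        mono_f := inferInstanceAs (Mono (𝟙 Y))
        epi_g := ⟨fun _ _ _ ↦ (isZero_zero C).eq_of_src _ _⟩ }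
    | s + 1 => counitSequence_shortExact adj (syzygy adj Y s)
  isZero := isZero_zero C

/-- The compatible splitting spectral sequence. -/
def spectralSequence [HasExt.{w} C] [Nonempty I] [∀ i, (G i).Faithful] (adj : ∀ i, F i ⊣ G i)
    (Y X : C) : CohomologicalSpectralSequenceNat AddCommGrpCat.{w} 1 :=
  (resolution adj Y).spectralSequence X

/-- The term `E_2^{s,t}` of the compatible splitting spectral sequence. -/
def E₂ [HasExt.{w} C] [Nonempty I] [∀ i, (G i).Faithful] (adj : ∀ i, F i ⊣ G i)
    (Y X : C) (s t : ℕ) : AddCommGrpCat.{w} :=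
  ((spectralSequence adj Y X).page 2).X (s, t)

end CompatibleSplitting

end

/-!
Write `ε` for the counit `FG ⟶ 𝟭 C`. The first terms of the complex `E_1^{*,t}` for `(Y, X)` are
`Ext^t(Y, X) → Ext^t(FG Y, X) → Ext^t(FG (ker ε_Y), X)`, so that `E_2^{0,t}` and `E_2^{1,t}` vanish
if and only if `T := Ext^t(-, X)` makes `0 → T Y → T (FG Y) → T (FG (ker ε_Y))` exact. Once this
holds for all `Y`, the map `T (ker ε_Y) → T (FG (ker ε_Y))` is injective, and `FG (ker ε_Y)` may be
replaced by `ker ε_Y`: this is left exactness of `T` on the sequences `0 → ker ε_Y → FG Y → Y → 0`.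

A short exact sequence `0 → A → B → Q → 0` is split by all the `G i` if and only if `ε_Q` lifts to
`l : FG Q ⟶ B`. Such a lift compares it with `0 → ker ε_Q → FG Q → Q → 0`, along which left
exactness of an additive functor is transported.
-/

namespace ExactCouple

variable (K : ExactCouple.{w})

/-- The differential `E_1^{s,t} → E_1^{s+1,t}` of the first page, as a map between the groups
`E (s, t)` themselves rather than the subquotients used in `ExactCouple.d`. -/
def d₁ (s t : ℕ) : K.E (s, t) →+ K.E (s + 1, t) := (K.j (s + 1) t).comp (K.k s t)

lemma Z_one (s t : ℕ) : K.Z 1 (s, t) = (K.d₁ s t).ker := by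
  ext x
  let x' : K.Z 0 (s, t) := ⟨x, K.Z_zero (s, t) ▸ AddSubgroup.mem_top x⟩
  have h : Rel 0 (s, t) (s + 1, t) := ⟨rfl, rfl⟩
  rw [← K.d_cls_eq_zero h x', d_cls, K.dZ_eq h x' (K.k s t x) rfl, cls_eq_zero, B_zero]
  rfl

lemma B_one_zero (t : ℕ) : K.B 1 (0, t) = ⊥ := by
  ext x
  rw [← B_zero]
  exact (K.mem_B_succ_of_le (b := (0, t)) le_rfl x).symm

lemma B_one_succ (s t : ℕ) : K.B 1 (s + 1, t) = (K.d₁ s t).range := by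
  ext x
  rw [mem_B, pow_one]
  constructor
  · rintro ⟨y, hy, rfl⟩
    rw [I_single, Pi.single_eq_zero_iff] at hy
    obtain ⟨e, rfl⟩ := (K.exact_ki s t y).1 hy
    exact ⟨e, rfl⟩
  · rintro ⟨e, rfl⟩
    refine ⟨K.k s t e, ?_, rfl⟩
    rw [I_single, (K.exact_ki s t).apply_apply_eq_zero, Pi.single_zero]

lemma isZero_page_two_iff (p : ℕ × ℕ) :
    IsZero ((K.spectralSequence.page 2).X p) ↔ K.Z 1 p ≤ K.B 1 p := by
  have h : IsZero ((K.spectralSequence.page 2).X p) ↔ Subsingleton (K.Page 1 p) :=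
    AddCommGrpCat.isZero_iff_subsingleton (G := AddCommGrpCat.of (K.Page 1 p))
  rw [h, QuotientAddGroup.subsingleton_iff, AddSubgroup.addSubgroupOf_eq_top]

lemma isZero_page_two_zero_iff (t : ℕ) :
    IsZero ((K.spectralSequence.page 2).X (0, t)) ↔ Function.Injective (K.d₁ 0 t) := by
  rw [isZero_page_two_iff, Z_one, B_one_zero, le_bot_iff, AddMonoidHom.ker_eq_bot_iff]

lemma isZero_page_two_succ_iff (s t : ℕ) :
    IsZero ((K.spectralSequence.page 2).X (s + 1, t)) ↔
      Function.Exact (K.d₁ s t) (K.d₁ (s + 1) t) := by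
  have range_le_ker : (K.d₁ s t).range ≤ (K.d₁ (s + 1) t).ker := by
    rw [← B_one_succ, ← Z_one]
    exact K.B_le_Z 1 (s + 1, t)
  rw [isZero_page_two_iff, Z_one, B_one_succ, AddMonoidHom.exact_iff]
  exact ⟨fun h ↦ h.antisymm range_le_ker, fun h ↦ h.le⟩

end ExactCouple

namespace SplicedResolution

variable {C : Type u} [Category.{v} C] [Abelian C]

/-- The differential `U (s + 1) ⟶ U s` of the complex obtained by splicing. -/
def d (R : SplicedResolution C) (s : ℕ) : R.U (s + 1) ⟶ R.U s := R.π (s + 1) ≫ R.ι s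

variable [HasExt.{w} C] (R : SplicedResolution C) (X : C)

lemma coe_exactCouple_d₁ (s t : ℕ) :
    ⇑((R.exactCouple X).d₁ s t) = ((extFunctor.{w} t).flip.obj X).map (R.d s).op :=
  funext fun x ↦ Ext.mk₀_comp_mk₀_assoc (R.π (s + 1)) (R.ι s) x

lemma isZero_page_two_zero_iff (t : ℕ) :
    IsZero (((R.spectralSequence.{w} X).page 2).X (0, t)) ↔
      Function.Injective (((extFunctor.{w} t).flip.obj X).map (R.d 0).op) := by
  rw [← coe_exactCouple_d₁]
  exact (R.exactCouple X).isZero_page_two_zero_iff t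

lemma isZero_page_two_succ_iff (s t : ℕ) :
    IsZero (((R.spectralSequence.{w} X).page 2).X (s + 1, t)) ↔
      Function.Exact (((extFunctor.{w} t).flip.obj X).map (R.d s).op)
        (((extFunctor.{w} t).flip.obj X).map (R.d (s + 1)).op) := by
  rw [← coe_exactCouple_d₁, ← coe_exactCouple_d₁]
  exact (R.exactCouple X).isZero_page_two_succ_iff s t

end SplicedResolution

lemma isSplitEpi_map_iff_exists_lift_counit {C : Type u} [Category.{v} C] {D : Type u₂}
    [Category.{v₂} D] {L : D ⥤ C} {R : C ⥤ D} (adj : L ⊣ R) {A B : C} (g : A ⟶ B) :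
    IsSplitEpi (R.map g) ↔ ∃ l : L.obj (R.obj B) ⟶ A, l ≫ g = adj.counit.app B := by
  constructor
  · intro h
    refine ⟨(adj.homEquiv _ _).symm (section_ (R.map g)), ?_⟩
    rw [← Adjunction.homEquiv_naturality_right_symm, IsSplitEpi.id, Adjunction.homEquiv_symm_id]
  · rintro ⟨l, hl⟩
    refine ⟨⟨⟨adj.unit.app (R.obj B) ≫ R.map l, ?_⟩⟩⟩
    rw [Category.assoc, ← R.map_comp, hl, adj.right_triangle_components]

lemma isSplitEpi_pi'_map_iff {C : Type u} [Category.{v} C] {I : Type u₁} {D : I → Type u₂}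
    [∀ i, Category.{v₂} (D i)] (G : ∀ i, C ⥤ D i) {A B : C} (g : A ⟶ B) :
    IsSplitEpi ((Functor.pi' G).map g) ↔ ∀ i, IsSplitEpi ((G i).map g) := by
  refine ⟨fun _ i ↦ inferInstanceAs (IsSplitEpi ((Pi.eval D i).map ((Functor.pi' G).map g))), ?_⟩
  intro h
  exact ⟨⟨⟨fun i ↦ (h i).exists_splitEpi.some.section_,
    funext fun i ↦ (h i).exists_splitEpi.some.id⟩⟩⟩

instance additive_flip_obj {C D E : Type*} [Category* C] [Category* D] [Category* E]
    [Preadditive C] [Preadditive E] (T : C ⥤ D ⥤ E) [T.Additive] (X : D) :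
    (T.flip.obj X).Additive where
  map_add := by simp [T.map_add]

lemma map_comp_op_apply {C : Type u} [Category.{v} C] (T : Cᵒᵖ ⥤ AddCommGrpCat.{w}) {A B Q : C}
    (f : A ⟶ B) (g : B ⟶ Q) (x : T.obj (.op Q)) :
    T.map (f ≫ g).op x = T.map f.op (T.map g.op x) := by
  rw [op_comp, T.map_comp, ConcreteCategory.comp_apply]

section LeftExactness

variable {C : Type u} [Category.{v} C] [Abelian C]

/-- A contravariant functor `T` sends `A → B → Q` to an exact sequence `0 → T Q → T B → T A`: this
is the condition imposed by `IsLeftRelExact` on each member of a class of sequences. -/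
def IsLeftExactAt (T : Cᵒᵖ ⥤ AddCommGrpCat.{w}) (S : ShortComplex C) : Prop :=
  Function.Injective (T.map S.g.op) ∧ Function.Exact (T.map S.g.op) (T.map S.f.op)

lemma map_op_eq_zero_of_exact {T : Cᵒᵖ ⥤ AddCommGrpCat.{w}} {S : ShortComplex C} (hS : S.Exact)
    [Mono S.f] {x : T.obj (.op S.X₂)} (hx : T.map S.f.op x = 0) {A : C} {a : A ⟶ S.X₂}
    (ha : a ≫ S.g = 0) : T.map a.op x = 0 := by
  rw [← hS.lift_f a ha, map_comp_op_apply, hx, map_zero]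

lemma isLeftExactAt_of_exists_lift {T : Cᵒᵖ ⥤ AddCommGrpCat.{w}} [T.Additive] {P : C → C}
    {p : ∀ Y, P Y ⟶ Y} (hp : ∀ {A B : C} (g : A ⟶ B), ∃ Pg : P A ⟶ P B, Pg ≫ p B = p A ≫ g)
    (hT : ∀ Y, IsLeftExactAt T (.mk (kernel.ι (p Y)) (p Y) (kernel.condition _)))
    {S : ShortComplex C} (hS : S.Exact) [Mono S.f] (lift : ∃ l, l ≫ S.g = p S.X₃) :
    IsLeftExactAt T S := by
  obtain ⟨l, hl⟩ := lift
  obtain ⟨Pg, hPg⟩ := hp S.g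
  refine ⟨fun y z hyz ↦ (hT S.X₃).1 ?_, fun x ↦ ⟨fun hx ↦ ?_, ?_⟩⟩
  · simp only [← hl, map_comp_op_apply, hyz]
  · have map_kernel_eq_zero : T.map (kernel.ι (p S.X₃)).op (T.map l.op x) = 0 := by
      rw [← map_comp_op_apply]
      exact map_op_eq_zero_of_exact hS hx (by rw [Category.assoc, hl, kernel.condition])
    obtain ⟨z, hz : T.map (p S.X₃).op z = T.map l.op x⟩ := ((hT S.X₃).2 _).1 map_kernel_eq_zero
    have map_sub_eq_zero : T.map (Pg ≫ l - p S.X₂).op x = 0 :=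
      map_op_eq_zero_of_exact hS hx
        (by rw [Preadditive.sub_comp, Category.assoc, hl, hPg, sub_self])
    refine ⟨z, (hT S.X₂).1 ?_⟩
    calc T.map (p S.X₂).op (T.map S.g.op z)
        = T.map Pg.op (T.map (p S.X₃).op z) := by
          rw [← map_comp_op_apply, ← map_comp_op_apply, hPg]
      _ = T.map (Pg ≫ l).op x := by rw [hz, map_comp_op_apply]
      _ = T.map (p S.X₂).op x := by
          rw [← sub_eq_zero, ← map_sub_eq_zero, op_sub, T.map_sub]
          rfl
  · rintro ⟨z, rfl⟩
    rw [← map_comp_op_apply, S.zero, op_zero, T.map_zero]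
    rfl

end LeftExactness

namespace CompatibleSplitting

attribute [local instance] Abelian.hasFiniteBiproducts

variable {C : Type u} [Category.{v} C] [Abelian C] {I : Type u₁}
  {D : I → Type u₂} [∀ i, Category.{v₂} (D i)] {F : ∀ i, D i ⥤ C} {G : ∀ i, C ⥤ D i}

lemma splitClass_of_iso {S S' : ShortComplex C} (e : S ≅ S') (hS : splitClass G S) :
    splitClass G S' := by
  refine ⟨ShortComplex.shortExact_of_iso e hS.1, fun i ↦ ?_⟩
  have hg : S'.g = e.inv.τ₂ ≫ S.g ≫ e.hom.τ₃ := by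
    rw [← e.hom.comm₂₃, ← ShortComplex.comp_τ₂_assoc, e.inv_hom_id, ShortComplex.id_τ₂,
      Category.id_comp]
  have := hS.2 i
  rw [hg, Functor.map_comp, Functor.map_comp]
  infer_instance

variable [Finite I] (adj : ∀ i, F i ⊣ G i)

lemma splitClass_iff_exists_lift_ε (S : ShortComplex C) :
    splitClass G S ↔ S.ShortExact ∧ ∃ l : (FG F G).obj S.X₃ ⟶ S.X₂, l ≫ S.g = ε adj S.X₃ :=
  and_congr_right fun _ ↦
    (isSplitEpi_pi'_map_iff G S.g).symm.trans
      (isSplitEpi_map_iff_exists_lift_counit (adjunction adj) S.g)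

lemma splitClass_of_counitClass [Nonempty I] [∀ i, (G i).Faithful] {S : ShortComplex C}
    (hS : counitClass adj S) : splitClass G S := by
  obtain ⟨Y, ⟨e⟩⟩ := hS
  exact splitClass_of_iso e.symm <| (splitClass_iff_exists_lift_ε adj _).2
    ⟨counitSequence_shortExact adj Y, 𝟙 _, Category.id_comp _⟩

lemma isLeftRelExact_tfae [Nonempty I] [∀ i, (G i).Faithful] (T : Cᵒᵖ ⥤ AddCommGrpCat.{w})
    [T.Additive] :
    [IsLeftRelExact (splitClass G) T,
      IsLeftRelExact (counitClass adj) T,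
      ∀ Y, IsLeftExactAt T (counitSequence adj Y)].TFAE := by
  tfae_have 1 → 2 := fun h S hS ↦ h S (splitClass_of_counitClass adj hS)
  tfae_have 2 → 3 := fun h Y ↦ h (counitSequence adj Y) ⟨Y, ⟨Iso.refl _⟩⟩
  tfae_have 3 → 1 := fun h S hS ↦
    have := hS.1.mono_f
    isLeftExactAt_of_exists_lift
      (fun g ↦ ⟨(FG F G).map g, (adjunction adj).counit.naturality g⟩) h hS.1.exact
      ((splitClass_iff_exists_lift_ε adj S).1 hS).2
  tfae_finish

lemma forall_isLeftExactAt_counitSequence_iff (T : Cᵒᵖ ⥤ AddCommGrpCat.{w}) :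
    (∀ Y, IsLeftExactAt T (counitSequence adj Y)) ↔
      ∀ Y, Function.Injective (T.map (ε adj Y).op) ∧
        Function.Exact (T.map (ε adj Y).op)
          (T.map (ε adj (kernel (ε adj Y)) ≫ kernel.ι (ε adj Y)).op) := by
  have exact_iff (h : ∀ Y, Function.Injective (T.map (ε adj Y).op)) (Y : C) :
      Function.Exact (T.map (ε adj Y).op) (T.map (kernel.ι (ε adj Y)).op) ↔
        Function.Exact (T.map (ε adj Y).op)
          (T.map (ε adj (kernel (ε adj Y)) ≫ kernel.ι (ε adj Y)).op) := by
    refine forall_congr' fun x ↦ iff_congr ?_ Iff.rfl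
    rw [map_comp_op_apply, map_eq_zero_iff _ (h _)]
  exact ⟨fun h Y ↦ ⟨(h Y).1, (exact_iff (fun Y ↦ (h Y).1) Y).1 (h Y).2⟩,
    fun h Y ↦ ⟨(h Y).1, (exact_iff (fun Y ↦ (h Y).1) Y).2 (h Y).2⟩⟩

lemma resolution_d_zero [Nonempty I] [∀ i, (G i).Faithful] (Y : C) :
    (resolution adj Y).d 0 = ε adj Y :=
  Category.comp_id (ε adj Y)

variable [HasExt.{w} C] [Nonempty I] [∀ i, (G i).Faithful]

lemma isZero_E₂_zero_iff (Y X : C) (t : ℕ) :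
    IsZero (E₂.{w} adj Y X 0 t) ↔
      Function.Injective (((extFunctor.{w} t).flip.obj X).map (ε adj Y).op) := by
  have h := (resolution adj Y).isZero_page_two_zero_iff.{w} X t
  rwa [resolution_d_zero] at h

lemma isZero_E₂_one_iff (Y X : C) (t : ℕ) :
    IsZero (E₂.{w} adj Y X 1 t) ↔
      Function.Exact (((extFunctor.{w} t).flip.obj X).map (ε adj Y).op)
        (((extFunctor.{w} t).flip.obj X).map
          (ε adj (kernel (ε adj Y)) ≫ kernel.ι (ε adj Y)).op) := by
  have h := (resolution adj Y).isZero_page_two_succ_iff.{w} X 0 t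
  rwa [resolution_d_zero] at h

lemma forall_isZero_E₂_iff (X : C) (t : ℕ) :
    (∀ Y : C, IsZero (E₂.{w} adj Y X 0 t) ∧ IsZero (E₂.{w} adj Y X 1 t)) ↔
      ∀ Y, IsLeftExactAt ((extFunctor.{w} t).flip.obj X) (counitSequence adj Y) := by
  simp only [isZero_E₂_zero_iff, isZero_E₂_one_iff, forall_isLeftExactAt_counitSequence_iff]

end CompatibleSplitting

theorem mainTheorem10_general {C : Type u} [Category.{v} C] [Abelian C] [HasExt.{w} C]
    {I : Type u₁} [Finite I] [Nonempty I] {D : I → Type u₂} [∀ i, Category.{v₂} (D i)]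
    {F : ∀ i, D i ⥤ C} {G : ∀ i, C ⥤ D i} (adj : ∀ i, F i ⊣ G i) [∀ i, (G i).Faithful]
    (X : C) (t : ℕ) :
    (IsLeftRelExact (CompatibleSplitting.splitClass G) ((extFunctor.{w} t).flip.obj X) ↔
      ∀ Y : C, IsZero (CompatibleSplitting.E₂.{w} adj Y X 0 t) ∧
        IsZero (CompatibleSplitting.E₂.{w} adj Y X 1 t)) ∧
    (IsLeftRelExact (CompatibleSplitting.counitClass adj) ((extFunctor.{w} t).flip.obj X) ↔
      ∀ Y : C, IsZero (CompatibleSplitting.E₂.{w} adj Y X 0 t) ∧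
        IsZero (CompatibleSplitting.E₂.{w} adj Y X 1 t)) := by
  have tfae := CompatibleSplitting.isLeftRelExact_tfae adj ((extFunctor.{w} t).flip.obj X)
  rw [CompatibleSplitting.forall_isZero_E₂_iff]
  exact ⟨tfae.out 0 2, tfae.out 1 2⟩

theorem mainTheorem10 {C : Type u} [Category.{v} C] [Abelian C] [HasExt.{w} C]
    {I : Type u₁} [Finite I] [Nonempty I]
    {D : I → Type u₂} [∀ i, Category.{v₂} (D i)] [∀ i, Abelian (D i)]
    {F : ∀ i, D i ⥤ C} {G : ∀ i, C ⥤ D i} (adj : ∀ i, F i ⊣ G i)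
    [∀ i, (G i).Faithful]
    [∀ i, PreservesFiniteLimits (G i)] [∀ i, PreservesFiniteColimits (G i)]
    [∀ i, PreservesFiniteLimits (F i)] [∀ i, PreservesFiniteColimits (F i)]
    (hF : ∀ i, IsResolving (F i))
    (hinj : EnoughRelInjectives (CompatibleSplitting.splitClass G))
    (X : C) (t : ℕ) :
    (IsLeftRelExact (CompatibleSplitting.splitClass G) ((extFunctor.{w} t).flip.obj X) ↔
      ∀ Y : C, IsZero (CompatibleSplitting.E₂.{w} adj Y X 0 t) ∧
        IsZero (CompatibleSplitting.E₂.{w} adj Y X 1 t)) ∧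
    (IsLeftRelExact (CompatibleSplitting.counitClass adj) ((extFunctor.{w} t).flip.obj X) ↔
      ∀ Y : C, IsZero (CompatibleSplitting.E₂.{w} adj Y X 0 t) ∧
        IsZero (CompatibleSplitting.E₂.{w} adj Y X 1 t)) := by
  exact mainTheorem10_general adj X t
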